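/- Let $E$ be a complex Hilbert space of finite dimension, let $\mathcal L(E)$ be the algebra of linear operators on $E$, let $L^2(E)$ and $L^2(\mathcal L(E))$ be the spaces of square integrable functions on the unit circle $\mathbb T$ (normalized arc length) with values in $E$ and $\mathcal L(E)$, and let $H^2(E)$, $H^2(\mathcal L(E))$ be their subspaces of functions with vanishing negative Fourier coefficients, identified with functions analytic in the unit disc. Let $\Theta$ be a pure inner function, that is, $\Theta\in H^2(\mathcal L(E))$, $\Theta(\zeta)$ is unitary for almost every $\zeta\in\mathbb T$, and $\|\Theta(0)\|<1$. Let $\mathcal K_\Theta=H^2(E)\ominus\Theta H^2(E)$, with orthogonal projection $P_\Theta:L^2(E)\to\mathcal K_\Theta$, and let $\mathcal M_\Theta$ be the orthogonal complement of $\Theta H^2(\mathcal L(E))$ in $H^2(\mathcal L(E))$, where $\mathcal L(E)$ carries the Hilbert–Schmidt inner product. Put $k_0^\Theta(z)=I-\Theta(z)\Theta(0)^*$. For $\Phi\in L^2(\mathcal L(E))$ and a bounded operator $A$ on $\mathcal K_\Theta$ we write $A=A_\Phi$ if $Af=P_\Theta(\Phi f)$ for every bounded function $f\in\mathcal K_\Theta$;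 the operator $A$ is called a matrix-valued truncated Toeplitz operator if $A=A_\Phi$ for some $\Phi\in L^2(\mathcal L(E))$. For a function $\Psi$, let $\Psi^*$ denote the pointwise adjoint. Let $A$ be a matrix-valued truncated Toeplitz operator on $\mathcal K_\Theta$. Then: 1. There exist $\Psi_1,\Psi_2\in\mathcal M_\Theta$ such that $A=A_{\Psi_1+\Psi_2^*}$. 2. Suppose that $\Psi_1,\Psi_2\in\mathcal M_\Theta$ satisfy $A=A_{\Psi_1+\Psi_2^*}$. Then $\Psi_1',\Psi_2'\in L^2(\mathcal L(E))$ satisfy $\Psi_1',\Psi_2'\in\mathcal M_\Theta$ and $A=A_{\Psi_1'+\Psi_2'^*}$ if and only if there is $X\in\mathcal L(E)$ with $$\Psi_1'=\Psi_1+k_0^\Theta X,\qquad \Psi_2'=\Psi_2-k_0^\Theta X^*.$$ -/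

import Mathlib

open MeasureTheory AddCircle
open scoped ENNReal ComplexConjugate InnerProductSpace

noncomputable section

namespace MTTO

instance two_pi_pos_fact : Fact (0 < 2 * Real.pi) := ⟨Real.two_pi_pos⟩

/-- The unit circle, parametrized by `t ↦ e^{it}`, with `t` taken modulo `2π`.  The function
`ζ = e^{it}` on it is `fourier 1`. -/
abbrev Torus : Type := AddCircle (2 * Real.pi)

/-- Normalized arc length `dt / 2π`. -/
abbrev arc : Measure Torus := haarAddCircle

/-- `L²(F)`: square integrable functions on the circle with values in `F`, modulo equality almost
everywhere.  It is used with `F = E` and `F = 𝓛(E)`. -/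
abbrev L2 (F : Type*) [NormedAddCommGroup F] : Type _ := Lp F 2 arc

section Hardy

theorem integrable_L2 {F : Type*} [NormedAddCommGroup F] (f : L2 F) : Integrable f arc :=
  (Lp.memLp f).integrable (by norm_num)

/-- The Hardy space `H²(F)`: the functions in `L²(F)` with vanishing negative Fourier
coefficients. -/
def hardy (F : Type*) [NormedAddCommGroup F] [NormedSpace ℂ F] : Submodule ℂ (L2 F) where
  carrier := {f | ∀ n : ℤ, n < 0 → fourierCoeff f n = 0}
  zero_mem' := by
    intro n _
    rw [fourierCoeff_congr_ae (Lp.coeFn_zero F 2 arc)]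
    simp [fourierCoeff]
  add_mem' := by
    intro f g hf hg n hn
    rw [fourierCoeff_congr_ae (Lp.coeFn_add f g),
      fourierCoeff.add (integrable_L2 f) (integrable_L2 g), Pi.add_apply, hf n hn, hg n hn,
      add_zero]
  smul_mem' := by
    intro c f hf n hn
    rw [fourierCoeff_congr_ae (Lp.coeFn_smul c f)]
    exact (fourierCoeff.const_smul f c n).trans (by rw [hf n hn, smul_zero])

/-- The value at a point `z` of the unit disc of the analytic extension
`∑_{n ≥ 0} zⁿ F̂(n)` of a function in `H²(F)`. -/
def discValue {F : Type*} [NormedAddCommGroup F] [NormedSpace ℂ F] (f : L2 F) (z : ℂ) : F := ∑' n : ℕ, z ^ n • fourierCoeff f (n : ℤ)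

end Hardy

section Model

variable {E : Type*} [NormedAddCommGroup E] [InnerProductSpace ℂ E]

/-- The subspace `Θ H²(E)` of `L²(E)`. -/
def thetaHardy (Θ : L2 (E →L[ℂ] E)) : Submodule ℂ (L2 E) where
  carrier := {h | ∃ g ∈ hardy E, h =ᵐ[arc] fun t => Θ t (g t)}
  zero_mem' := by
    refine ⟨0, zero_mem _, ?_⟩
    filter_upwards [Lp.coeFn_zero E 2 arc] with t ht
    rw [ht, Pi.zero_apply, map_zero]
  add_mem' := by
    rintro a b ⟨g, hg, ha⟩ ⟨k, hk, hb⟩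
    refine ⟨g + k, add_mem hg hk, ?_⟩
    filter_upwards [ha, hb, Lp.coeFn_add a b, Lp.coeFn_add g k] with t h1 h2 h3 h4
    rw [h3, Pi.add_apply, h1, h2, h4, Pi.add_apply, map_add]
  smul_mem' := by
    rintro c a ⟨g, hg, ha⟩
    refine ⟨c • g, Submodule.smul_mem _ c hg, ?_⟩
    filter_upwards [ha, Lp.coeFn_smul c a, Lp.coeFn_smul c g] with t h1 h2 h3
    rw [h2, Pi.smul_apply, h1, h3, Pi.smul_apply, map_smul]

/-- The model space `K_Θ = H²(E) ⊖ Θ H²(E)`. -/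
def modelSpace (Θ : L2 (E →L[ℂ] E)) : Submodule ℂ (L2 E) := hardy E ⊓ (thetaHardy Θ)ᗮ

/-- The product `Φ f` in `L²(E)` of `Φ ∈ L²(𝓛(E))` and an (essentially) bounded `f ∈ L²(E)`. -/
def mulBounded (Φ : L2 (E →L[ℂ] E)) (f : L2 E) (hf : MemLp f ∞ arc) : L2 E :=
  MemLp.toLp (fun t => Φ t (f t))
    ((ContinuousLinearMap.id ℂ (E →L[ℂ] E)).memLp_of_bilin 2 (Lp.memLp Φ) hf)

variable [CompleteSpace E]

theorem isClosed_hardy : IsClosed (hardy E : Set (L2 E)) := by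
  have h : (hardy E : Set (L2 E)) = ⋂ n : ℤ, ⋂ _ : n < 0, {f : L2 E | fourierCoeff f n = 0} := by
    ext f
    simp [hardy]
  rw [h]
  refine isClosed_iInter fun n => isClosed_iInter fun _ => ?_
  have hL : LipschitzWith 1 (fun f : L2 E => fourierCoeff f n) := by
    refine LipschitzWith.of_dist_le_mul fun f g => ?_
    rw [dist_eq_norm, dist_eq_norm, NNReal.coe_one, one_mul]
    have h1 : fourierCoeff f n - fourierCoeff g n
        = ∫ t, fourier (-n) t • ((f - g : L2 E) : Torus → E) t ∂arc := by
      unfold fourierCoeff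
      rw [← integral_sub ((integrable_L2 f).fourier_smul (-n))
        ((integrable_L2 g).fourier_smul (-n))]
      refine integral_congr_ae ?_
      filter_upwards [Lp.coeFn_sub f g] with t ht
      rw [ht, Pi.sub_apply, smul_sub]
    rw [h1]
    have h2 : eLpNorm ((f - g : L2 E) : Torus → E) 1 arc
        ≤ eLpNorm ((f - g : L2 E) : Torus → E) 2 arc :=
      eLpNorm_le_eLpNorm_of_exponent_le (by norm_num) (Lp.aestronglyMeasurable _)
    calc ‖∫ t, fourier (-n) t • ((f - g : L2 E) : Torus → E) t ∂arc‖
        ≤ ∫ t, ‖fourier (-n) t • ((f - g : L2 E) : Torus → E) t‖ ∂arc :=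
          norm_integral_le_integral_norm _
      _ = ∫ t, ‖((f - g : L2 E) : Torus → E) t‖ ∂arc := by
          congr 1
          ext t
          rw [norm_smul, fourier_apply, Circle.norm_coe, one_mul]
      _ = (eLpNorm ((f - g : L2 E) : Torus → E) 1 arc).toReal := by
          rw [integral_norm_eq_lintegral_enorm (Lp.aestronglyMeasurable _),
            eLpNorm_one_eq_lintegral_enorm]
      _ ≤ ‖f - g‖ := by
          rw [Lp.norm_def]
          exact ENNReal.toReal_mono (Lp.eLpNorm_ne_top _) h2
  exact isClosed_eq hL.continuous continuous_const

instance completeSpace_modelSpace (Θ : L2 (E →L[ℂ] E)) : CompleteSpace (modelSpace Θ) := by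
  have h : IsClosed (modelSpace Θ : Set (L2 E)) := by
    rw [modelSpace, Submodule.coe_inf]
    exact isClosed_hardy.inter (Submodule.isClosed_orthogonal _)
  exact h.completeSpace_coe

/-- `Θ` is an inner function: it lies in `H²(𝓛(E))` and its boundary values are almost everywhere
unitary operators. -/
def IsInner (Θ : L2 (E →L[ℂ] E)) : Prop :=
  Θ ∈ hardy (E →L[ℂ] E) ∧ ∀ᵐ t ∂arc, Θ t ∈ unitary (E →L[ℂ] E)

/-- `Θ` is pure: `‖Θ(0)‖ < 1`. -/
def IsPure (Θ : L2 (E →L[ℂ] E)) : Prop := ‖discValue Θ 0‖ < 1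

/-- The boundary values of
`k_λ^Θ(z) = (1 - conj λ z)⁻¹ (I - Θ(z) Θ(λ)^*)`, where `z = e^{it}`. -/
def kernelFun (Θ : L2 (E →L[ℂ] E)) (l : ℂ) (t : Torus) : E →L[ℂ] E :=
  (1 - conj l * fourier 1 t)⁻¹ • (1 - Θ t * star (discValue Θ l))

/-- `A = A_Φ^Θ`: the map `f ↦ P_Θ (Φ f)`, defined on the bounded functions in `K_Θ`, is bounded
and `A` is its continuous extension to `K_Θ`. -/
def HasSymbol (Θ : L2 (E →L[ℂ] E)) (A : modelSpace Θ →L[ℂ] modelSpace Θ)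
    (Φ : L2 (E →L[ℂ] E)) : Prop :=
  ∀ (f : modelSpace Θ) (hf : MemLp (f : L2 E) ∞ arc),
    A f = (modelSpace Θ).orthogonalProjectionOnto (mulBounded Φ (f : L2 E) hf)

/-- `A` is a matrix-valued truncated Toeplitz operator on `K_Θ`. -/
def IsMTTO (Θ : L2 (E →L[ℂ] E)) (A : modelSpace Θ →L[ℂ] modelSpace Θ) : Prop :=
  ∃ Φ : L2 (E →L[ℂ] E), HasSymbol Θ A Φ

/-- The Hilbert–Schmidt inner product `tr (S^* T)` on `𝓛(E)`. -/
def hsInner (S T : E →L[ℂ] E) : ℂ :=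
  LinearMap.trace ℂ E ((star S * T : E →L[ℂ] E) : E →ₗ[ℂ] E)

/-- The subspace `Θ H²(𝓛(E))` of `L²(𝓛(E))`. -/
def thetaHardyOp (Θ : L2 (E →L[ℂ] E)) : Set (L2 (E →L[ℂ] E)) :=
  {H | ∃ G ∈ hardy (E →L[ℂ] E), H =ᵐ[arc] fun t => Θ t * G t}

/-- The space `M_Θ`: the orthogonal complement of `Θ H²(𝓛(E))` in `H²(𝓛(E))`, with respect to the
inner product of `L²(𝓛(E))` that comes from the Hilbert–Schmidt inner product on `𝓛(E)`. -/
def symbolSpace (Θ : L2 (E →L[ℂ] E)) : Set (L2 (E →L[ℂ] E)) :=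
  {Ψ | Ψ ∈ hardy (E →L[ℂ] E) ∧
    ∀ H ∈ thetaHardyOp Θ, ∫ t, hsInner (H t) (Ψ t) ∂arc = 0}

end Model

end MTTO

end

/-! The argument replaces orthogonality by conditions on Fourier spectra. Since `Θ` is unitary a.e.,
`f` lies in `K_Θ` iff `f` is analytic and `Θ^* f` has only negative frequencies, and likewise for
`M_Θ` (`IsInner.mem_modelSpace_iff`, `IsInner.mem_symbolSpace_iff`). Two symbols of `A` differ by
one whose form vanishes on `K_Θ` (`HasSymbol.iff_zeroSymbol`), so everything is a question about
zero symbols.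

Existence: split `Φ = F + R` with `F` and `R^*` analytic, and write each as an element of `M_Θ` plus
`Θ G` (`exists_symbol_decomposition`). The terms `Θ G₁ + (Θ G₂)^*` induce zero
(`zeroSymbol_of_analytic`).

Uniqueness: let `U + V^*` be a zero symbol with `U, V ∈ M_Θ`. The form vanishes at `(f, g)` and at
their backward shifts, that is, at `(f - f(0), g - g(0))`; subtracting leaves `⟨U f(0), g⟩ + ⟨f, V
g(0)⟩ = 0` (`ZeroSymbol.integral_mean`). By purity `k_0(0) = I - Θ(0)Θ(0)^*` is invertible, with
inverse `D`. Taking `f = k_0 D y` and using the reproducing property of `k_0` gives `U = k_0 X` with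
`X = -V(0)^* D`; then `g = k_0 D y` and the density of bounded functions give `V = -k_0 X^*`. -/

noncomputable section

namespace MTTO

/-! ### Fourier coefficients and one-sided spectra of vector-valued functions -/

section Fourier

variable {F F' : Type*} [NormedAddCommGroup F] [NormedSpace ℂ F]
  [NormedAddCommGroup F'] [NormedSpace ℂ F']

theorem integrable_of_memLp_two {F : Type*} [NormedAddCommGroup F] {f : Torus → F} (hf : MemLp f 2 arc) : Integrable f arc :=
  hf.integrable (by norm_num)

theorem fourierCoeff_clm_comp [CompleteSpace F] [CompleteSpace F'] (L : F →L[ℂ] F')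
    {f : Torus → F} (hf : Integrable f arc) (n : ℤ) :
    fourierCoeff (fun t => L (f t)) n = L (fourierCoeff f n) := by
  unfold fourierCoeff
  rw [← L.integral_comp_comm (hf.fourier_smul (-n))]
  simp

theorem fourierCoeff_semilinear_comp [CompleteSpace F] [CompleteSpace F'] (L : F →L⋆[ℂ] F')
    {f : Torus → F} (hf : Integrable f arc) (n : ℤ) :
    fourierCoeff (fun t => L (f t)) n = L (fourierCoeff f (-n)) := by
  -- Regarded as real-linear, `L` commutes with the integral; conjugating `z^{-n}` then reverses the
  -- index.
  let L' : F →L[ℝ] F' :=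
    { toFun := L
      map_add' := map_add L
      map_smul' := fun r x => by
        have := L.map_smulₛₗ (r : ℂ) x
        simpa using this
      cont := L.continuous }
  have hL : ∀ x, L' x = L x := fun _ => rfl
  unfold fourierCoeff
  rw [← hL, ← L'.integral_comp_comm (hf.fourier_smul _)]
  refine integral_congr_ae (.of_forall fun t => ?_)
  simp only [hL, L.map_smulₛₗ, fourier_neg, neg_neg]

theorem fourierCoeff_fourier_smul (f : Torus → F) (m n : ℤ) :
    fourierCoeff (fun t => fourier m t • f t) n = fourierCoeff f (n - m) := by
  unfold fourierCoeff
  refine integral_congr_ae (.of_forall fun t => ?_)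
  simp only [← mul_smul, ← fourier_add]
  congr 3
  ring

theorem fourierCoeff_const [CompleteSpace F] (c : F) (n : ℤ) :
    fourierCoeff (fun _ : Torus => c) n = if n = 0 then c else 0 := by
  have h : ∫ t : Torus, fourier (-n) t ∂arc = if n = 0 then 1 else 0 := by
    have := congr_fun (fourierCoeff_fourier (T := 2 * Real.pi) (-n)) 0
    simp only [fourierCoeff, neg_zero, fourier_zero, one_smul, Pi.single_apply] at this
    rw [this]
    simp [eq_comm]
  unfold fourierCoeff
  rw [integral_smul_const, h]
  split_ifs <;> simp

theorem fourierCoeff_sub {f g : Torus → F} (hf : Integrable f arc) (hg : Integrable g arc)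
    (n : ℤ) : fourierCoeff (fun t => f t - g t) n = fourierCoeff f n - fourierCoeff g n := by
  unfold fourierCoeff
  rw [← integral_sub (hf.fourier_smul _) (hg.fourier_smul _)]
  simp [smul_sub]

theorem fourierCoeff_add {f g : Torus → F} (hf : Integrable f arc) (hg : Integrable g arc)
    (n : ℤ) : fourierCoeff (fun t => f t + g t) n = fourierCoeff f n + fourierCoeff g n := by
  unfold fourierCoeff
  rw [← integral_add (hf.fourier_smul _) (hg.fourier_smul _)]
  simp [smul_add]

theorem fourierCoeff_zero_index (f : Torus → F) : fourierCoeff f 0 = ∫ t, f t ∂arc := by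
  simp [fourierCoeff]

theorem memLp_fourier_smul {f : Torus → F} {p : ℝ≥0∞} (hf : MemLp f p arc) (m : ℤ) :
    MemLp (fun t => fourier m t • f t) p arc := by
  refine hf.of_le ((map_continuous (fourier m)).aestronglyMeasurable.smul hf.1)
    (.of_forall fun t => ?_)
  rw [norm_smul, fourier_apply, Circle.norm_coe, one_mul]

/-- Parseval: the integral is the sum of the products of the coefficient of `f` at `-n` and that of
`g` at `n`. -/
theorem integral_mul_eq_zero {f g : Torus → ℂ} (hf : MemLp f 2 arc) (hg : MemLp g 2 arc)
    (h : ∀ n, fourierCoeff f (-n) = 0 ∨ fourierCoeff g n = 0) :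
    ∫ t, f t * g t ∂arc = 0 := by
  have h1 := (fourierBasis (T := 2 * Real.pi)).tsum_inner_mul_inner hf.star.toLp hg.toLp
  rw [L2.inner_def] at h1
  have h2 : ∫ t, f t * g t ∂arc = ∫ t, ⟪hf.star.toLp _ t, hg.toLp _ t⟫_ℂ ∂arc := by
    refine integral_congr_ae ?_
    filter_upwards [hf.star.coeFn_toLp, hg.coeFn_toLp] with t ht1 ht2
    rw [ht1, ht2]
    simp [mul_comm]
  rw [h2, ← h1]
  refine (tsum_congr fun n => ?_).trans tsum_zero
  rw [← inner_conj_symm, ← HilbertBasis.repr_apply_apply, ← HilbertBasis.repr_apply_apply,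
    fourierBasis_repr, fourierBasis_repr, fourierCoeff_congr_ae hf.star.coeFn_toLp,
    fourierCoeff_congr_ae hg.coeFn_toLp]
  have h3 : fourierCoeff (star f) n = star (fourierCoeff f (-n)) :=
    fourierCoeff_semilinear_comp (starL ℂ : ℂ ≃L⋆[ℂ] ℂ).toContinuousLinearMap
      (integrable_of_memLp_two hf) n
  rw [h3]
  rcases h n with h | h <;> simp [h]

theorem integrable_apply {f : Torus → F →L[ℂ] F'} {g : Torus → F} (hf : MemLp f 2 arc)
    (hg : MemLp g 2 arc) : Integrable (fun t => f t (g t)) arc :=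
  memLp_one_iff_integrable.1
    ((ContinuousLinearMap.id ℂ (F →L[ℂ] F')).memLp_of_bilin 1 hf hg)

theorem memLp_clm_comp {f : Torus → F} {p : ℝ≥0∞} (L : F →L[ℂ] F') (hf : MemLp f p arc) :
    MemLp (fun t => L (f t)) p arc := L.comp_memLp' hf

theorem integral_apply_eq_zero [FiniteDimensional ℂ F] [CompleteSpace F']
    {f : Torus → F →L[ℂ] F'} {g : Torus → F}
    (hf : MemLp f 2 arc) (hg : MemLp g 2 arc)
    (h : ∀ n, fourierCoeff f (-n) = 0 ∨ fourierCoeff g n = 0) :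
    ∫ t, f t (g t) ∂arc = 0 := by
  have := FiniteDimensional.complete ℂ F
  -- A functional on `F'` and a basis of `F` turn the integral into a finite sum of scalar ones.
  refine SeparatingDual.eq_zero_of_forall_dual_eq_zero (R := ℂ) fun φ => ?_
  rw [← φ.integral_comp_comm (integrable_apply hf hg)]
  let b := Module.finBasis ℂ F
  let c : ∀ i, F →L[ℂ] ℂ := fun i => (b.coord i).toContinuousLinearMap
  let d : ∀ i, (F →L[ℂ] F') →L[ℂ] ℂ := fun i => φ ∘L (ContinuousLinearMap.apply ℂ F' (b i))
  have h1 : ∀ t, φ (f t (g t)) = ∑ i, d i (f t) * c i (g t) := by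
    intro t
    have h2 := congrArg (fun v => φ (f t v)) (b.sum_repr (g t))
    simp only [map_sum, map_smul, smul_eq_mul] at h2
    simp [c, d, ← h2, mul_comm]
  simp only [h1]
  rw [integral_finsetSum]
  · refine Finset.sum_eq_zero fun i _ => integral_mul_eq_zero (memLp_clm_comp _ hf)
      (memLp_clm_comp _ hg) fun n => ?_
    rw [fourierCoeff_clm_comp _ (integrable_of_memLp_two hf),
      fourierCoeff_clm_comp _ (integrable_of_memLp_two hg)]
    rcases h n with h | h <;> simp [h]
  · intro i _
    exact (memLp_clm_comp (c i) hg).integrable_mul (memLp_clm_comp (d i) hf) |>.congr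
      (.of_forall fun t => by simp [mul_comm])

/-- The Fourier coefficients of index `< a` vanish. -/
def SpecGE (a : ℤ) (f : Torus → F) : Prop := ∀ n < a, fourierCoeff f n = 0

/-- The Fourier coefficients of index `> a` vanish. -/
def SpecLE (a : ℤ) (f : Torus → F) : Prop := ∀ n, a < n → fourierCoeff f n = 0

theorem SpecGE.congr {a : ℤ} {f g : Torus → F} (h : SpecGE a f) (hfg : f =ᵐ[arc] g) :
    SpecGE a g := fun n hn => by rw [← fourierCoeff_congr_ae hfg, h n hn]

theorem SpecLE.congr {a : ℤ} {f g : Torus → F} (h : SpecLE a f) (hfg : f =ᵐ[arc] g) :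
    SpecLE a g := fun n hn => by rw [← fourierCoeff_congr_ae hfg, h n hn]

theorem SpecGE.mono {a b : ℤ} {f : Torus → F} (h : SpecGE a f) (hab : b ≤ a) : SpecGE b f :=
  fun n hn => h n (hn.trans_le hab)

theorem SpecLE.mono {a b : ℤ} {f : Torus → F} (h : SpecLE a f) (hab : a ≤ b) : SpecLE b f :=
  fun n hn => h n (hab.trans_lt hn)

theorem SpecGE.sub {a : ℤ} {f g : Torus → F} (hf : SpecGE a f) (hg : SpecGE a g)
    (if' : Integrable f arc) (ig : Integrable g arc) : SpecGE a (fun t => f t - g t) :=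
  fun n hn => by rw [fourierCoeff_sub if' ig, hf n hn, hg n hn, sub_zero]

theorem SpecLE.sub {a : ℤ} {f g : Torus → F} (hf : SpecLE a f) (hg : SpecLE a g)
    (if' : Integrable f arc) (ig : Integrable g arc) : SpecLE a (fun t => f t - g t) :=
  fun n hn => by rw [fourierCoeff_sub if' ig, hf n hn, hg n hn, sub_zero]

theorem SpecGE.add {a : ℤ} {f g : Torus → F} (hf : SpecGE a f) (hg : SpecGE a g)
    (if' : Integrable f arc) (ig : Integrable g arc) : SpecGE a (fun t => f t + g t) :=
  fun n hn => by rw [fourierCoeff_add if' ig, hf n hn, hg n hn, add_zero]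

theorem SpecLE.add {a : ℤ} {f g : Torus → F} (hf : SpecLE a f) (hg : SpecLE a g)
    (if' : Integrable f arc) (ig : Integrable g arc) : SpecLE a (fun t => f t + g t) :=
  fun n hn => by rw [fourierCoeff_add if' ig, hf n hn, hg n hn, add_zero]

theorem SpecGE.fourier_smul {a : ℤ} {f : Torus → F} (h : SpecGE a f) (m : ℤ) :
    SpecGE (a + m) (fun t => fourier m t • f t) :=
  fun n hn => by rw [fourierCoeff_fourier_smul, h _ (by omega)]

theorem SpecLE.fourier_smul {a : ℤ} {f : Torus → F} (h : SpecLE a f) (m : ℤ) :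
    SpecLE (a + m) (fun t => fourier m t • f t) :=
  fun n hn => by rw [fourierCoeff_fourier_smul, h _ (by omega)]

theorem SpecGE.const [CompleteSpace F] (c : F) : SpecGE 0 (fun _ : Torus => c) :=
  fun n hn => by rw [fourierCoeff_const, if_neg hn.ne]

theorem SpecLE.const [CompleteSpace F] (c : F) : SpecLE 0 (fun _ : Torus => c) :=
  fun n hn => by rw [fourierCoeff_const, if_neg hn.ne']

theorem SpecGE.clm [CompleteSpace F] [CompleteSpace F'] {a : ℤ} {f : Torus → F}
    (h : SpecGE a f) (hf : Integrable f arc) (L : F →L[ℂ] F') : SpecGE a (fun t => L (f t)) :=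
  fun n hn => by rw [fourierCoeff_clm_comp L hf, h n hn, map_zero]

theorem SpecLE.clm [CompleteSpace F] [CompleteSpace F'] {a : ℤ} {f : Torus → F}
    (h : SpecLE a f) (hf : Integrable f arc) (L : F →L[ℂ] F') : SpecLE a (fun t => L (f t)) :=
  fun n hn => by rw [fourierCoeff_clm_comp L hf, h n hn, map_zero]

theorem SpecGE.semilinear [CompleteSpace F] [CompleteSpace F'] {a b : ℤ} {f : Torus → F}
    (h : SpecGE a f) (hf : Integrable f arc) (L : F →L⋆[ℂ] F') (hab : b = -a) :
    SpecLE b (fun t => L (f t)) :=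
  fun n hn => by rw [fourierCoeff_semilinear_comp L hf, h _ (by omega), map_zero]

theorem SpecLE.semilinear [CompleteSpace F] [CompleteSpace F'] {a b : ℤ} {f : Torus → F}
    (h : SpecLE a f) (hf : Integrable f arc) (L : F →L⋆[ℂ] F') (hab : b = -a) :
    SpecGE b (fun t => L (f t)) :=
  fun n hn => by rw [fourierCoeff_semilinear_comp L hf, h _ (by omega), map_zero]

theorem SpecGE.apply [FiniteDimensional ℂ F] [CompleteSpace F'] {a b : ℤ}
    {f : Torus → F →L[ℂ] F'} {g : Torus → F} (hf : SpecGE a f) (hg : SpecGE b g)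
    (mf : MemLp f 2 arc) (mg : MemLp g 2 arc) : SpecGE (a + b) (fun t => f t (g t)) := by
  intro n hn
  have := integral_apply_eq_zero mf (memLp_fourier_smul mg (-n)) fun k => by
    rw [fourierCoeff_fourier_smul]
    by_cases hk : -k < a
    · exact .inl (hf _ hk)
    · exact .inr (hg _ (by omega))
  simpa [fourierCoeff] using this

theorem SpecLE.apply [FiniteDimensional ℂ F] [CompleteSpace F'] {a b : ℤ}
    {f : Torus → F →L[ℂ] F'} {g : Torus → F} (hf : SpecLE a f) (hg : SpecLE b g)
    (mf : MemLp f 2 arc) (mg : MemLp g 2 arc) : SpecLE (a + b) (fun t => f t (g t)) := by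
  intro n hn
  have := integral_apply_eq_zero mf (memLp_fourier_smul mg (-n)) fun k => by
    rw [fourierCoeff_fourier_smul]
    by_cases hk : a < -k
    · exact .inl (hf _ hk)
    · exact .inr (hg _ (by omega))
  simpa [fourierCoeff] using this

/-- A square integrable function all of whose Fourier coefficients vanish is zero. -/
theorem ae_eq_zero_of_fourierCoeff [FiniteDimensional ℂ F] {f : Torus → F}
    (hf : MemLp f 2 arc) (h : ∀ n, fourierCoeff f n = 0) : f =ᵐ[arc] 0 := by
  have := FiniteDimensional.complete ℂ F
  let b := Module.finBasis ℂ F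
  have h1 : ∀ i, ∀ᵐ t ∂arc, b.coord i (f t) = 0 := by
    intro i
    have hm : MemLp (fun t => b.coord i (f t)) 2 arc :=
      memLp_clm_comp (b.coord i).toContinuousLinearMap hf
    have h2 : hm.toLp = 0 := by
      refine (fourierBasis (T := 2 * Real.pi)).repr.map_eq_zero_iff.1 ?_
      ext n
      rw [fourierBasis_repr, fourierCoeff_congr_ae hm.coeFn_toLp]
      have := fourierCoeff_clm_comp (b.coord i).toContinuousLinearMap (integrable_of_memLp_two hf) n
      rw [h n] at this
      simpa using this
    have h3 := hm.coeFn_toLp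
    rw [h2] at h3
    filter_upwards [h3, Lp.coeFn_zero ℂ 2 arc] with t h4 h5
    rw [← h4, h5, Pi.zero_apply]
  filter_upwards [ae_all_iff.2 h1] with t ht
  refine b.ext_elem fun i => ?_
  simpa using ht i

/-- The analytic part of a scalar function. -/
theorem exists_riesz_scalar {f : Torus → ℂ} (hf : MemLp f 2 arc) :
    ∃ g : Torus → ℂ, MemLp g 2 arc ∧ SpecGE 0 g ∧ SpecLE (-1) (fun t => f t - g t) := by
  have : CompleteSpace (hardy ℂ) := (isClosed_hardy (E := ℂ)).completeSpace_coe
  let g := (hardy ℂ).starProjection hf.toLp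
  have hg : g ∈ hardy ℂ := (hardy ℂ).starProjection_apply_mem _
  refine ⟨g, Lp.memLp g, hg, fun n hn => ?_⟩
  -- The remainder is orthogonal to `H²`, hence to every `z^n` with `n ≥ 0`, which kills its
  -- nonnegative coefficients.
  have h1 : hf.toLp - g ∈ (hardy ℂ)ᗮ := (hardy ℂ).sub_starProjection_mem_orthogonal _
  have h2 : fourierLp 2 n ∈ hardy ℂ := by
    intro k hk
    rw [fourierCoeff_congr_ae (coeFn_fourierLp 2 n), fourierCoeff_fourier, Pi.single_apply,
      if_neg (by omega)]
  have h3 := h1 _ h2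
  rw [← coe_fourierBasis, ← HilbertBasis.repr_apply_apply, fourierBasis_repr] at h3
  rw [← h3]
  refine congr_fun (fourierCoeff_congr_ae ?_) n
  filter_upwards [Lp.coeFn_sub hf.toLp g, hf.coeFn_toLp] with t h4 h5
  rw [h4, Pi.sub_apply, h5]

/-- The analytic part of a function with values in a finite-dimensional space. -/
theorem exists_riesz [FiniteDimensional ℂ F] {f : Torus → F} (hf : MemLp f 2 arc) :
    ∃ g : Torus → F, MemLp g 2 arc ∧ SpecGE 0 g ∧ SpecLE (-1) (fun t => f t - g t) := by
  have := FiniteDimensional.complete ℂ F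
  let b := Module.finBasis ℂ F
  let c : ∀ i, F →L[ℂ] ℂ := fun i => (b.coord i).toContinuousLinearMap
  let L : ∀ i, ℂ →L[ℂ] F := fun i => (ContinuousLinearMap.id ℂ ℂ).smulRight (b i)
  have hc : ∀ i, MemLp (fun t => c i (f t)) 2 arc := fun i => memLp_clm_comp _ hf
  choose g hg1 hg2 hg3 using fun i => exists_riesz_scalar (hc i)
  -- The coordinate projections are assembled one basis vector at a time; the full index set
  -- recovers `f`.
  have key : ∀ (s : Finset (Fin (Module.finrank ℂ F))),
      MemLp (fun t => ∑ i ∈ s, L i (g i t)) 2 arc ∧ SpecGE 0 (fun t => ∑ i ∈ s, L i (g i t)) ∧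
      SpecLE (-1) (fun t => ∑ i ∈ s, L i (c i (f t) - g i t)) := by
    intro s
    induction s using Finset.induction_on with
    | empty => exact ⟨by simp, fun n _ => by simp [fourierCoeff], fun n _ => by simp [fourierCoeff]⟩
    | insert i s hi ih =>
      obtain ⟨h1, h2, h3⟩ := ih
      simp only [Finset.sum_insert hi]
      have m1 := memLp_clm_comp (L i) (hg1 i)
      have m2 := (hc i).sub (hg1 i)
      refine ⟨m1.add h1, ((hg2 i).clm (integrable_of_memLp_two (hg1 i)) (L i)).add h2
        (integrable_of_memLp_two m1) (integrable_of_memLp_two h1),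
        ((hg3 i).clm (integrable_of_memLp_two m2) (L i)).add h3
        (integrable_of_memLp_two (memLp_clm_comp (L i) m2)) ?_⟩
      exact integrable_finsetSum _ fun j _ =>
        integrable_of_memLp_two (memLp_clm_comp (L j) ((hc j).sub (hg1 j)))
  obtain ⟨h1, h2, h3⟩ := key Finset.univ
  refine ⟨_, h1, h2, ?_⟩
  refine h3.congr (.of_forall fun t => ?_)
  simp only [map_sub, Finset.sum_sub_distrib]
  congr 1
  simp [L, c]

end Fourier

/-! ### Removing the mean from a function with one-sided spectrum -/

section Spectrum

variable {F : Type*} [NormedAddCommGroup F] [NormedSpace ℂ F] [CompleteSpace F]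

theorem SpecGE.sub_mean {f : Torus → F} (h : SpecGE 0 f) (hf : Integrable f arc) :
    SpecGE 1 (fun t => f t - fourierCoeff f 0) := by
  intro n hn
  rw [fourierCoeff_sub hf (integrable_const _), fourierCoeff_const]
  split_ifs with h0
  · rw [h0, sub_self]
  · rw [h n (by omega), sub_zero]

theorem SpecLE.sub_mean {f : Torus → F} (h : SpecLE 0 f) (hf : Integrable f arc) :
    SpecLE (-1) (fun t => f t - fourierCoeff f 0) := by
  intro n hn
  rw [fourierCoeff_sub hf (integrable_const _), fourierCoeff_const]
  split_ifs with h0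
  · rw [h0, sub_self]
  · rw [h n (by omega), sub_zero]

end Spectrum

/-! ### Integrals of pointwise inner products -/

section InnerIntegral

variable {E : Type*} [NormedAddCommGroup E] [InnerProductSpace ℂ E]

theorem integrable_inner_of_memLp {u v : Torus → E} (hu : MemLp u 2 arc) (hv : MemLp v 2 arc) :
    Integrable (fun t => ⟪u t, v t⟫_ℂ) arc := by
  refine (L2.integrable_inner (𝕜 := ℂ) (hu.toLp u) (hv.toLp v)).congr ?_
  filter_upwards [hu.coeFn_toLp, hv.coeFn_toLp] with t h1 h2
  rw [h1, h2]

theorem inner_toLp_toLp {u v : Torus → E} (hu : MemLp u 2 arc) (hv : MemLp v 2 arc) :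
    ⟪hu.toLp u, hv.toLp v⟫_ℂ = ∫ t, ⟪u t, v t⟫_ℂ ∂arc := by
  rw [L2.inner_def]
  refine integral_congr_ae ?_
  filter_upwards [hu.coeFn_toLp, hv.coeFn_toLp] with t h1 h2
  rw [h1, h2]

theorem integral_inner_swap (u v : Torus → E) :
    ∫ t, ⟪u t, v t⟫_ℂ ∂arc = conj (∫ t, ⟪v t, u t⟫_ℂ ∂arc) := by
  rw [← integral_conj]
  simp [inner_conj_symm]

theorem ae_eq_of_forall_apply [FiniteDimensional ℂ E] {Φ Ψ : Torus → E →L[ℂ] E}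
    (h : ∀ x, ∀ᵐ t ∂arc, Φ t x = Ψ t x) : Φ =ᵐ[arc] Ψ := by
  let b := Module.finBasis ℂ E
  filter_upwards [ae_all_iff.2 fun i => h (b i)] with t ht
  have : (Φ t : E →ₗ[ℂ] E) = Ψ t := b.ext ht
  exact ContinuousLinearMap.coe_injective this

theorem ae_eq_zero_of_integral_inner_self {w : Torus → E} (hw : MemLp w 2 arc)
    (h : ∫ t, ⟪w t, w t⟫_ℂ ∂arc = 0) : w =ᵐ[arc] 0 := by
  rw [← inner_toLp_toLp hw hw, inner_self_eq_zero] at h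
  have h1 := hw.coeFn_toLp
  rw [h] at h1
  exact h1.symm.trans (Lp.coeFn_zero E 2 arc)

end InnerIntegral

/-! ### Spectra of operator-valued functions and their products -/

section Operator

variable {E : Type*} [NormedAddCommGroup E] [InnerProductSpace ℂ E] [CompleteSpace E]

theorem memLp_apply_right {Φ : Torus → E →L[ℂ] E} {f : Torus → E} (hΦ : MemLp Φ 2 arc)
    (hf : MemLp f ∞ arc) : MemLp (fun t => Φ t (f t)) 2 arc :=
  (ContinuousLinearMap.id ℂ (E →L[ℂ] E)).memLp_of_bilin 2 hΦ hf

theorem memLp_apply_left {Φ : Torus → E →L[ℂ] E} {f : Torus → E} {p : ℝ≥0∞}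
    (hΦ : MemLp Φ ∞ arc) (hf : MemLp f p arc) : MemLp (fun t => Φ t (f t)) p arc :=
  (ContinuousLinearMap.id ℂ (E →L[ℂ] E)).memLp_of_bilin p hΦ hf

theorem memLp_mul_left {Φ Ψ : Torus → E →L[ℂ] E} {p : ℝ≥0∞} (hΦ : MemLp Φ ∞ arc)
    (hΨ : MemLp Ψ p arc) : MemLp (fun t => Φ t * Ψ t) p arc :=
  (ContinuousLinearMap.mul ℂ (E →L[ℂ] E)).memLp_of_bilin p hΦ hΨ

theorem memLp_apply_const {Φ : Torus → E →L[ℂ] E} {p : ℝ≥0∞} (hΦ : MemLp Φ p arc) (x : E) :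
    MemLp (fun t => Φ t x) p arc :=
  memLp_clm_comp (ContinuousLinearMap.apply ℂ E x) hΦ

theorem memLp_mul_const {Φ : Torus → E →L[ℂ] E} {p : ℝ≥0∞} (hΦ : MemLp Φ p arc)
    (X : E →L[ℂ] E) : MemLp (fun t => Φ t * X) p arc :=
  memLp_clm_comp ((ContinuousLinearMap.mul ℂ (E →L[ℂ] E)).flip X) hΦ

/-- The pointwise adjoint as a continuous conjugate-linear map. -/
def adjL : (E →L[ℂ] E) →L⋆[ℂ] (E →L[ℂ] E) :=
  (starL ℂ : (E →L[ℂ] E) ≃L⋆[ℂ] (E →L[ℂ] E)).toContinuousLinearMap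

theorem inner_star_apply (T : E →L[ℂ] E) (x y : E) : ⟪x, star T y⟫_ℂ = ⟪T x, y⟫_ℂ := by
  rw [ContinuousLinearMap.star_eq_adjoint, ContinuousLinearMap.adjoint_inner_right]

theorem inner_apply_star (T : E →L[ℂ] E) (x y : E) : ⟪star T x, y⟫_ℂ = ⟪x, T y⟫_ℂ := by
  rw [ContinuousLinearMap.star_eq_adjoint, ContinuousLinearMap.adjoint_inner_left]

theorem SpecGE.star {a b : ℤ} {Φ : Torus → E →L[ℂ] E} (h : SpecGE a Φ)
    (hΦ : Integrable Φ arc) (hab : b = -a) : SpecLE b (fun t => star (Φ t)) :=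
  h.semilinear hΦ adjL hab

theorem SpecLE.star {a b : ℤ} {Φ : Torus → E →L[ℂ] E} (h : SpecLE a Φ)
    (hΦ : Integrable Φ arc) (hab : b = -a) : SpecGE b (fun t => star (Φ t)) :=
  h.semilinear hΦ adjL hab

theorem fourierCoeff_star {Φ : Torus → E →L[ℂ] E} (hΦ : Integrable Φ arc) (n : ℤ) :
    fourierCoeff (fun t => star (Φ t)) n = star (fourierCoeff Φ (-n)) :=
  fourierCoeff_semilinear_comp adjL hΦ n

theorem fourierCoeff_apply_const {Φ : Torus → E →L[ℂ] E} (hΦ : Integrable Φ arc) (x : E) (n : ℤ) :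
    fourierCoeff (fun t => Φ t x) n = fourierCoeff Φ n x :=
  fourierCoeff_clm_comp (ContinuousLinearMap.apply ℂ E x) hΦ n

theorem SpecGE.apply_const {a : ℤ} {Φ : Torus → E →L[ℂ] E} (h : SpecGE a Φ)
    (hΦ : Integrable Φ arc) (x : E) : SpecGE a (fun t => Φ t x) :=
  h.clm hΦ (ContinuousLinearMap.apply ℂ E x)

theorem SpecLE.apply_const {a : ℤ} {Φ : Torus → E →L[ℂ] E} (h : SpecLE a Φ)
    (hΦ : Integrable Φ arc) (x : E) : SpecLE a (fun t => Φ t x) :=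
  h.clm hΦ (ContinuousLinearMap.apply ℂ E x)

theorem SpecGE.mul_const {a : ℤ} {Φ : Torus → E →L[ℂ] E} (h : SpecGE a Φ)
    (hΦ : Integrable Φ arc) (X : E →L[ℂ] E) : SpecGE a (fun t => Φ t * X) :=
  h.clm hΦ ((ContinuousLinearMap.mul ℂ (E →L[ℂ] E)).flip X)

theorem SpecLE.mul_const {a : ℤ} {Φ : Torus → E →L[ℂ] E} (h : SpecLE a Φ)
    (hΦ : Integrable Φ arc) (X : E →L[ℂ] E) : SpecLE a (fun t => Φ t * X) :=
  h.clm hΦ ((ContinuousLinearMap.mul ℂ (E →L[ℂ] E)).flip X)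

theorem integral_inner_const_right {u : Torus → E} (hu : Integrable u arc) (c : E) :
    ∫ t, ⟪u t, c⟫_ℂ ∂arc = ⟪∫ t, u t ∂arc, c⟫_ℂ := by
  rw [integral_inner_swap u (fun _ => c), integral_inner hu, inner_conj_symm]

variable [FiniteDimensional ℂ E]

/-- Pairing with `u` in the conjugate-linear slot reflects its spectrum to `≤ -a`, so the integrand
has spectrum `≤ b - a < 0` and mean zero. -/
theorem integral_inner_eq_zero {a b : ℤ} {u v : Torus → E} (hu : MemLp u 2 arc)
    (hv : MemLp v 2 arc) (su : SpecGE a u) (sv : SpecLE b v) (hab : b < a) :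
    ∫ t, ⟪u t, v t⟫_ℂ ∂arc = 0 := by
  have h := SpecLE.apply (su.semilinear (integrable_of_memLp_two hu) (innerSL ℂ) rfl) sv
    ((innerSL ℂ (E := E)).comp_memLp' hu) hv 0 (by omega)
  rw [fourierCoeff_zero_index] at h
  simpa using h

theorem integral_inner_eq_zero' {a b : ℤ} {u v : Torus → E} (hu : MemLp u 2 arc)
    (hv : MemLp v 2 arc) (su : SpecGE a u) (sv : SpecLE b v) (hab : b < a) :
    ∫ t, ⟪v t, u t⟫_ℂ ∂arc = 0 := by
  rw [integral_inner_swap, integral_inner_eq_zero hu hv su sv hab, map_zero]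

/-- Evaluation at `0` is multiplicative on analytic functions: `f - f(0)` has spectrum `≥ 1`, so `Φ
(f - f(0))` has mean zero. -/
theorem integral_apply_of_specGE {Φ : Torus → E →L[ℂ] E} {f : Torus → E} (hΦ : MemLp Φ 2 arc)
    (hf : MemLp f 2 arc) (sΦ : SpecGE 0 Φ) (sf : SpecGE 0 f) :
    ∫ t, Φ t (f t) ∂arc = fourierCoeff Φ 0 (fourierCoeff f 0) := by
  have hc : MemLp (fun t => f t - fourierCoeff f 0) 2 arc := hf.sub (memLp_const _)
  have h := SpecGE.apply sΦ (sf.sub_mean (integrable_of_memLp_two hf)) hΦ hc 0 (by norm_num)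
  rw [fourierCoeff_zero_index] at h
  rw [← fourierCoeff_apply_const (integrable_of_memLp_two hΦ), fourierCoeff_zero_index,
    ← sub_eq_zero, ← integral_sub (integrable_apply hΦ hf)
      (integrable_of_memLp_two (memLp_apply_const hΦ _)), ← h]
  simp

theorem SpecGE.mul {a b : ℤ} {Φ Ψ : Torus → E →L[ℂ] E} (sΦ : SpecGE a Φ) (sΨ : SpecGE b Ψ)
    (hΦ : MemLp Φ 2 arc) (hΨ : MemLp Ψ 2 arc) : SpecGE (a + b) (fun t => Φ t * Ψ t) :=
  SpecGE.apply (sΦ.clm (integrable_of_memLp_two hΦ) (ContinuousLinearMap.mul ℂ (E →L[ℂ] E))) sΨ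
    (memLp_clm_comp _ hΦ) hΨ

theorem SpecLE.mul {a b : ℤ} {Φ Ψ : Torus → E →L[ℂ] E} (sΦ : SpecLE a Φ) (sΨ : SpecLE b Ψ)
    (hΦ : MemLp Φ 2 arc) (hΨ : MemLp Ψ 2 arc) : SpecLE (a + b) (fun t => Φ t * Ψ t) :=
  SpecLE.apply (sΦ.clm (integrable_of_memLp_two hΦ) (ContinuousLinearMap.mul ℂ (E →L[ℂ] E))) sΨ
    (memLp_clm_comp _ hΦ) hΨ

end Operator

/-! ### Spectral description of `K_Θ` and `M_Θ` -/

section Inner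

variable {E : Type*} [NormedAddCommGroup E] [InnerProductSpace ℂ E] [CompleteSpace E]
  {Θ : L2 (E →L[ℂ] E)}

theorem IsInner.memLp_top (hΘ : IsInner Θ) : MemLp Θ ∞ arc := by
  refine memLp_top_of_bound (Lp.aestronglyMeasurable Θ) 1 ?_
  filter_upwards [hΘ.2] with t ht
  rcases subsingleton_or_nontrivial (E →L[ℂ] E) with h | h
  · rw [Subsingleton.elim (Θ t) 0, norm_zero]
    exact zero_le_one
  · exact (CStarRing.norm_of_mem_unitary ht).le

theorem IsInner.memLp_star (hΘ : IsInner Θ) : MemLp (fun t => star (Θ t)) ∞ arc :=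
  hΘ.memLp_top.star

theorem IsInner.star_apply_apply (hΘ : IsInner Θ) :
    ∀ᵐ t ∂arc, ∀ x, star (Θ t) (Θ t x) = x := by
  filter_upwards [hΘ.2] with t ht x
  have := congrArg (fun T : E →L[ℂ] E => T x) (Unitary.star_mul_self_of_mem ht)
  simpa using this

theorem IsInner.apply_star_apply (hΘ : IsInner Θ) :
    ∀ᵐ t ∂arc, ∀ x, Θ t (star (Θ t) x) = x := by
  filter_upwards [hΘ.2] with t ht x
  have := congrArg (fun T : E →L[ℂ] E => T x) (Unitary.mul_star_self_of_mem ht)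
  simpa using this

/-- A function `f` is (a representative of an element) in `K_Θ` exactly when it is square
integrable, `f` is analytic and `Θ^* f` is strictly antianalytic. -/
structure IsModel (Θ : L2 (E →L[ℂ] E)) (f : Torus → E) : Prop where
  memLp : MemLp f 2 arc
  specGE : SpecGE 0 f
  specLE : SpecLE (-1) (fun t => star (Θ t) (f t))

/-- The analogue of `IsModel` for operator-valued functions. -/
structure IsSymbol (Θ : L2 (E →L[ℂ] E)) (Ψ : Torus → E →L[ℂ] E) : Prop where
  memLp : MemLp Ψ 2 arc
  specGE : SpecGE 0 Ψ
  specLE : SpecLE (-1) (fun t => star (Θ t) * Ψ t)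

theorem IsModel.congr {f g : Torus → E} (hf : IsModel Θ f) (h : f =ᵐ[arc] g) : IsModel Θ g where
  memLp := hf.memLp.ae_eq h
  specGE := hf.specGE.congr h
  specLE := hf.specLE.congr (h.mono fun t ht => by simp only [ht])

theorem IsSymbol.congr {f g : Torus → E →L[ℂ] E} (hf : IsSymbol Θ f) (h : f =ᵐ[arc] g) :
    IsSymbol Θ g where
  memLp := hf.memLp.ae_eq h
  specGE := hf.specGE.congr h
  specLE := hf.specLE.congr (h.mono fun t ht => by simp only [ht])

variable [FiniteDimensional ℂ E]

theorem IsInner.mem_modelSpace_iff (hΘ : IsInner Θ) (f : L2 E) :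
    f ∈ modelSpace Θ ↔ IsModel Θ f := by
  have hf := Lp.memLp f
  have hΘf := memLp_apply_left hΘ.memLp_star hf
  constructor
  · rintro ⟨h1, h2⟩
    refine ⟨hf, h1, fun n hn => ext_inner_left ℂ fun x => ?_⟩
    -- Testing against `Θ z^n x` with `n ≥ 0` reads off the `n`-th coefficient of `Θ^* f`.
    have hu : MemLp (fun t : Torus => fourier n t • x) 2 arc :=
      memLp_fourier_smul (memLp_const x) n
    have hΘu := memLp_apply_left hΘ.memLp_top hu
    have hmem : hΘu.toLp ∈ thetaHardy Θ := by
      refine ⟨hu.toLp, ?_, ?_⟩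
      · exact (((SpecGE.const x).fourier_smul n).mono (by omega)).congr hu.coeFn_toLp.symm
      · filter_upwards [hΘu.coeFn_toLp, hu.coeFn_toLp] with t h3 h4
        rw [h3, h4]
    have h3 := h2 _ hmem
    rw [L2.inner_def] at h3
    rw [inner_zero_right, ← h3, fourierCoeff,
      ← integral_inner ((integrable_of_memLp_two hΘf).fourier_smul (-n))]
    refine integral_congr_ae ?_
    filter_upwards [hΘu.coeFn_toLp] with t h4
    rw [h4, inner_smul_right, inner_star_apply, map_smul, inner_smul_left, fourier_neg]
  · rintro ⟨_, h1, h2⟩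
    refine ⟨h1, ?_⟩
    rintro h ⟨g, hg, hgh⟩
    rw [L2.inner_def, ← integral_inner_eq_zero (Lp.memLp g) hΘf hg h2 (by norm_num)]
    refine integral_congr_ae ?_
    filter_upwards [hgh] with t ht
    rw [ht, inner_star_apply]

theorem IsInner.mem_symbolSpace_iff (hΘ : IsInner Θ) (Ψ : L2 (E →L[ℂ] E)) :
    Ψ ∈ symbolSpace Θ ↔ IsSymbol Θ Ψ := by
  have hΨ := Lp.memLp Ψ
  have hΘΨ := memLp_mul_left hΘ.memLp_star hΨ
  let tr : (E →L[ℂ] E) →L[ℂ] ℂ :=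
    ((LinearMap.trace ℂ E) ∘ₗ (ContinuousLinearMap.coeLM ℂ)).toContinuousLinearMap
  have htr : ∀ T : E →L[ℂ] E, tr T = LinearMap.trace ℂ E (T : E →ₗ[ℂ] E) := fun _ => rfl
  constructor
  · rintro ⟨h1, h2⟩
    refine ⟨hΨ, h1, fun n hn => ?_⟩
    refine ContinuousLinearMap.ext fun x => ext_inner_left ℂ fun y => ?_
    -- With this `T`, `tr (T^* C) = ⟨y, C x⟩`, so the Hilbert–Schmidt pairing with `Θ z^n T` yields
    -- each matrix entry of the `n`-th coefficient of `Θ^* Ψ`.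
    let T : E →L[ℂ] E := star (InnerProductSpace.rankOne ℂ x y)
    have hu : MemLp (fun t : Torus => fourier n t • T) 2 arc :=
      memLp_fourier_smul (memLp_const T) n
    have hΘu := memLp_mul_left hΘ.memLp_top hu
    have h3 := h2 hΘu.toLp ⟨hu.toLp,
      (((SpecGE.const T).fourier_smul n).mono (by omega)).congr hu.coeFn_toLp.symm, by
        filter_upwards [hΘu.coeFn_toLp, hu.coeFn_toLp] with t h3 h4
        rw [h3, h4]⟩
    have h4 : ∫ t, hsInner (hΘu.toLp _ t) (Ψ t) ∂arc
        = tr (star T * fourierCoeff (fun t => star (Θ t) * Ψ t) n) := by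
      have := (tr ∘L ContinuousLinearMap.mul ℂ (E →L[ℂ] E) (star T)).integral_comp_comm
        ((integrable_of_memLp_two hΘΨ).fourier_smul (-n))
      rw [fourierCoeff]
      simp only [ContinuousLinearMap.comp_apply, ContinuousLinearMap.mul_apply'] at this
      rw [← this]
      refine integral_congr_ae ?_
      filter_upwards [hΘu.coeFn_toLp] with t h4
      rw [h4, hsInner, htr]
      congr 2
      simp [mul_assoc]
    rw [h4] at h3
    rw [htr, star_star, ContinuousLinearMap.toLinearMap_mul, LinearMap.trace_mul_comm,
      ← ContinuousLinearMap.toLinearMap_mul, ContinuousLinearMap.mul_def,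
      InnerProductSpace.comp_rankOne, InnerProductSpace.trace_rankOne] at h3
    simpa using h3
  · rintro ⟨_, h1, h2⟩
    refine ⟨h1, ?_⟩
    rintro H ⟨G, hG, hGH⟩
    have mG := Lp.memLp G
    have h3 := SpecLE.mul (SpecGE.star hG (integrable_L2 G) rfl) h2 mG.star hΘΨ 0 (by norm_num)
    rw [fourierCoeff_zero_index] at h3
    have hi : Integrable (fun t => star (G t) * (star (Θ t) * Ψ t)) arc :=
      memLp_one_iff_integrable.1
        ((ContinuousLinearMap.mul ℂ (E →L[ℂ] E)).memLp_of_bilin 1 mG.star hΘΨ)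
    rw [← map_zero tr, ← h3, ← tr.integral_comp_comm hi]
    refine integral_congr_ae ?_
    filter_upwards [hGH] with t ht
    rw [ht, hsInner, htr, star_mul, mul_assoc]

end Inner

/-! ### The kernel `k_0^Θ`, the backward shift and zero symbols -/

section Model

variable {E : Type*} [NormedAddCommGroup E] [InnerProductSpace ℂ E] [CompleteSpace E]
  {Θ : L2 (E →L[ℂ] E)}

theorem discValue_zero {F : Type*} [NormedAddCommGroup F] [NormedSpace ℂ F] (f : L2 F) :
    discValue f 0 = fourierCoeff f 0 := by
  rw [discValue, tsum_eq_single 0 fun n hn => by simp [hn]]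
  simp

theorem kernelFun_zero (Θ : L2 (E →L[ℂ] E)) (t : Torus) :
    kernelFun Θ 0 t = 1 - Θ t * star (fourierCoeff Θ 0) := by
  simp [kernelFun, discValue_zero]

theorem memLp_top_kernelFun (hΘ : IsInner Θ) : MemLp (kernelFun Θ 0) ∞ arc := by
  have : kernelFun Θ 0 = fun t => 1 - Θ t * star (fourierCoeff Θ 0) := funext (kernelFun_zero Θ)
  rw [this]
  exact (memLp_const _).sub (memLp_mul_const hΘ.memLp_top _)

theorem specGE_kernelFun (hΘ : IsInner Θ) : SpecGE 0 (kernelFun Θ 0) := by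
  have : kernelFun Θ 0 = fun t => 1 - Θ t * star (fourierCoeff Θ 0) := funext (kernelFun_zero Θ)
  rw [this]
  exact (SpecGE.const _).sub (SpecGE.mul_const hΘ.1 (integrable_L2 Θ) _) (integrable_const _)
    (integrable_of_memLp_two (memLp_mul_const (Lp.memLp Θ) _))

theorem fourierCoeff_kernelFun (Θ : L2 (E →L[ℂ] E)) :
    fourierCoeff (kernelFun Θ 0) 0 = 1 - fourierCoeff Θ 0 * star (fourierCoeff Θ 0) := by
  have : kernelFun Θ 0 = fun t => 1 - Θ t * star (fourierCoeff Θ 0) := funext (kernelFun_zero Θ)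
  rw [this, fourierCoeff_sub (integrable_const _)
    (integrable_of_memLp_two (memLp_mul_const (Lp.memLp Θ) _)), fourierCoeff_const, if_pos rfl]
  congr 1
  exact fourierCoeff_clm_comp
    ((ContinuousLinearMap.mul ℂ (E →L[ℂ] E)).flip (star (fourierCoeff Θ 0))) (integrable_L2 Θ) 0

/-- By unitarity `Θ^*` cancels `Θ`. What remains is `Θ^*` minus its mean, which is strictly
antianalytic; this places `k_0^Θ` in `M_Θ`. -/
theorem star_mul_kernelFun (hΘ : IsInner Θ) :
    ∀ᵐ t ∂arc, star (Θ t) * kernelFun Θ 0 t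
      = star (Θ t) - fourierCoeff (fun t => star (Θ t)) 0 := by
  filter_upwards [hΘ.2] with t ht
  rw [fourierCoeff_star (integrable_L2 Θ), kernelFun_zero, mul_sub, mul_one, ← mul_assoc,
    Unitary.star_mul_self_of_mem ht, one_mul, neg_zero]

theorem isSymbol_kernelFun (hΘ : IsInner Θ) : IsSymbol Θ (kernelFun Θ 0) where
  memLp := (memLp_top_kernelFun hΘ).mono_exponent le_top
  specGE := specGE_kernelFun hΘ
  specLE := ((SpecGE.star hΘ.1 (integrable_L2 Θ) rfl).sub_mean
    (integrable_of_memLp_two (Lp.memLp Θ).star)).congr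
      ((star_mul_kernelFun hΘ).mono fun _ h => h.symm)

theorem IsSymbol.mul_const {Ψ : Torus → E →L[ℂ] E} (hΘ : IsInner Θ) (h : IsSymbol Θ Ψ)
    (X : E →L[ℂ] E) : IsSymbol Θ (fun t => Ψ t * X) where
  memLp := memLp_mul_const h.memLp X
  specGE := h.specGE.mul_const (integrable_of_memLp_two h.memLp) X
  specLE := (h.specLE.mul_const
    (integrable_of_memLp_two (memLp_mul_left hΘ.memLp_star h.memLp)) X).congr
      (.of_forall fun _ => mul_assoc _ _ _)

theorem IsSymbol.apply_const {Ψ : Torus → E →L[ℂ] E} (hΘ : IsInner Θ) (h : IsSymbol Θ Ψ)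
    (x : E) : IsModel Θ (fun t => Ψ t x) where
  memLp := memLp_apply_const h.memLp x
  specGE := h.specGE.apply_const (integrable_of_memLp_two h.memLp) x
  specLE := h.specLE.apply_const
    (integrable_of_memLp_two (memLp_mul_left hΘ.memLp_star h.memLp)) x

theorem IsSymbol.add {Φ Ψ : Torus → E →L[ℂ] E} (hΘ : IsInner Θ) (h : IsSymbol Θ Φ)
    (h' : IsSymbol Θ Ψ) : IsSymbol Θ (fun t => Φ t + Ψ t) where
  memLp := h.memLp.add h'.memLp
  specGE := h.specGE.add h'.specGE (integrable_of_memLp_two h.memLp)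
    (integrable_of_memLp_two h'.memLp)
  specLE := (h.specLE.add h'.specLE
    (integrable_of_memLp_two (memLp_mul_left hΘ.memLp_star h.memLp))
    (integrable_of_memLp_two (memLp_mul_left hΘ.memLp_star h'.memLp))).congr
      (.of_forall fun _ => (mul_add _ _ _).symm)

theorem IsSymbol.sub {Φ Ψ : Torus → E →L[ℂ] E} (hΘ : IsInner Θ) (h : IsSymbol Θ Φ)
    (h' : IsSymbol Θ Ψ) : IsSymbol Θ (fun t => Φ t - Ψ t) where
  memLp := h.memLp.sub h'.memLp
  specGE := h.specGE.sub h'.specGE (integrable_of_memLp_two h.memLp)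
    (integrable_of_memLp_two h'.memLp)
  specLE := (h.specLE.sub h'.specLE
    (integrable_of_memLp_two (memLp_mul_left hΘ.memLp_star h.memLp))
    (integrable_of_memLp_two (memLp_mul_left hΘ.memLp_star h'.memLp))).congr
      (.of_forall fun _ => (mul_sub _ _ _).symm)

theorem IsModel.add {f g : Torus → E} (hΘ : IsInner Θ) (h : IsModel Θ f)
    (h' : IsModel Θ g) : IsModel Θ (fun t => f t + g t) where
  memLp := h.memLp.add h'.memLp
  specGE := h.specGE.add h'.specGE (integrable_of_memLp_two h.memLp)
    (integrable_of_memLp_two h'.memLp)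
  specLE := (h.specLE.add h'.specLE
    (integrable_of_memLp_two (memLp_apply_left hΘ.memLp_star h.memLp))
    (integrable_of_memLp_two (memLp_apply_left hΘ.memLp_star h'.memLp))).congr
      (.of_forall fun t => (map_add (star (Θ t)) _ _).symm)

/-- The backward shift preserves `K_Θ`. -/
theorem IsModel.backwardShift {f : Torus → E} (hΘ : IsInner Θ) (h : IsModel Θ f) :
    IsModel Θ (fun t => fourier (-1) t • (f t - fourierCoeff f 0)) where
  memLp := memLp_fourier_smul (h.memLp.sub (memLp_const _)) (-1)
  specGE := ((h.specGE.sub_mean (integrable_of_memLp_two h.memLp)).fourier_smul (-1)).mono le_rfl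
  specLE := by
    have s : MemLp (fun t => star (Θ t)) 2 arc := (Lp.memLp Θ).star
    have h1 : SpecLE 0 (fun t => star (Θ t) (fourierCoeff f 0)) :=
      SpecLE.apply_const (SpecGE.star hΘ.1 (integrable_L2 Θ) rfl) (integrable_of_memLp_two s) _
    -- `Θ^* f - Θ^* f(0)` has spectrum `≤ 0`, and the factor `z^{-1}` lowers it to `≤ -1`.
    have h2 := (((h.specLE.mono (by norm_num : (-1 : ℤ) ≤ 0)).sub h1
      (integrable_of_memLp_two (memLp_apply_left hΘ.memLp_star h.memLp))
      (integrable_of_memLp_two (memLp_apply_const s _))).fourier_smul (-1))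
    exact h2.congr (.of_forall fun t => by simp only [map_smul, map_sub])

theorem memLp_top_backwardShift {E : Type*} [NormedAddCommGroup E] [InnerProductSpace ℂ E] {f : Torus → E} (h : MemLp f ∞ arc) :
    MemLp (fun t : Torus => fourier (-1) t • (f t - fourierCoeff f 0)) ∞ arc :=
  memLp_fourier_smul (h.sub (memLp_const _)) (-1)

/-- The form of `A_Φ` vanishes on `K_Θ`. -/
def ZeroSymbol (Θ : L2 (E →L[ℂ] E)) (Φ : Torus → E →L[ℂ] E) : Prop :=
  ∀ f g, IsModel Θ f → MemLp f ∞ arc → IsModel Θ g → ∫ t, ⟪g t, Φ t (f t)⟫_ℂ ∂arc = 0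

theorem ZeroSymbol.congr {Φ Ψ : Torus → E →L[ℂ] E} (h : ZeroSymbol Θ Φ) (hΦ : Φ =ᵐ[arc] Ψ) :
    ZeroSymbol Θ Ψ := by
  intro f g hf hf' hg
  rw [← h f g hf hf' hg]
  exact integral_congr_ae (hΦ.mono fun t ht => by simp only [ht])

theorem hasSymbol_inner_iff (A : modelSpace Θ →L[ℂ] modelSpace Θ)
    (Φ : L2 (E →L[ℂ] E)) : HasSymbol Θ A Φ ↔ ∀ (f g : modelSpace Θ),
      MemLp (f : L2 E) ∞ arc → ⟪g, A f⟫_ℂ = ∫ t, ⟪(g : L2 E) t, Φ t ((f : L2 E) t)⟫_ℂ ∂arc := by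
  have key : ∀ (f g : modelSpace Θ) (hf : MemLp (f : L2 E) ∞ arc),
      ⟪g, (modelSpace Θ).orthogonalProjectionOnto (mulBounded Φ (f : L2 E) hf)⟫_ℂ
        = ∫ t, ⟪(g : L2 E) t, Φ t ((f : L2 E) t)⟫_ℂ ∂arc := by
    intro f g hf
    rw [Submodule.inner_orthogonalProjectionOnto_eq_of_mem_left, L2.inner_def]
    refine integral_congr_ae ?_
    filter_upwards [(memLp_apply_right (Lp.memLp Φ) hf).coeFn_toLp] with t ht
    rw [mulBounded, ht]
  constructor
  · intro h f g hf
    rw [h f hf, key]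
  · intro h f hf
    exact ext_inner_left ℂ fun g => by rw [h f g hf, key]

variable [FiniteDimensional ℂ E]

/-- The reproducing property of `k_0^Θ`. -/
theorem IsModel.integral_inner_kernelFun {h : Torus → E} (hΘ : IsInner Θ) (hh : IsModel Θ h)
    (x : E) : ∫ t, ⟪h t, kernelFun Θ 0 t x⟫_ℂ ∂arc = ⟪fourierCoeff h 0, x⟫_ℂ := by
  have s : MemLp (fun t => star (Θ t) (h t)) 2 arc := memLp_apply_left hΘ.memLp_star hh.memLp
  -- `⟨h, k_0 x⟩ = ⟨h, x⟩ - ⟨Θ^* h, y⟩`, and `Θ^* h` has zero mean.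
  let y := star (fourierCoeff Θ 0) x
  have h1 : ∫ t, ⟪star (Θ t) (h t), y⟫_ℂ ∂arc = 0 :=
    integral_inner_eq_zero' (memLp_const y) s (SpecGE.const y) hh.specLE (by norm_num)
  have h2 : ∫ t, ⟪h t, x⟫_ℂ ∂arc = ⟪fourierCoeff h 0, x⟫_ℂ := by
    rw [integral_inner_const_right (integrable_of_memLp_two hh.memLp), fourierCoeff_zero_index]
  have h3 : ∀ t, ⟪h t, kernelFun Θ 0 t x⟫_ℂ = ⟪h t, x⟫_ℂ - ⟪star (Θ t) (h t), y⟫_ℂ := by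
    intro t
    rw [inner_apply_star, kernelFun_zero, ← inner_sub_right]
    rfl
  simp only [h3]
  rw [integral_sub (integrable_inner_of_memLp hh.memLp (memLp_const x))
    (integrable_inner_of_memLp s (memLp_const y)), h1, h2, sub_zero]

/-- `A` and each of its symbols are compared through the same form, with `f` bounded and `g`
arbitrary in `K_Θ`; subtracting the forms removes `A`. -/
theorem HasSymbol.iff_zeroSymbol (hΘ : IsInner Θ) {A : modelSpace Θ →L[ℂ] modelSpace Θ}
    {Φ : L2 (E →L[ℂ] E)} (h : HasSymbol Θ A Φ) (Φ' : L2 (E →L[ℂ] E)) :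
    HasSymbol Θ A Φ' ↔ ZeroSymbol Θ (fun t => Φ' t - Φ t) := by
  rw [hasSymbol_inner_iff] at h ⊢
  have key : ∀ {f g : Torus → E}, MemLp f ∞ arc → MemLp g 2 arc →
      ∫ t, ⟪g t, (Φ' t - Φ t) (f t)⟫_ℂ ∂arc
        = ∫ t, ⟪g t, Φ' t (f t)⟫_ℂ ∂arc - ∫ t, ⟪g t, Φ t (f t)⟫_ℂ ∂arc := by
    intro f g hf hg
    rw [← integral_sub
      (integrable_inner_of_memLp hg (memLp_apply_right (Lp.memLp Φ') hf))
      (integrable_inner_of_memLp hg (memLp_apply_right (Lp.memLp Φ) hf))]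
    simp
  constructor
  · intro h' f g hf hf' hg
    have ef := hf.memLp.coeFn_toLp
    have eg := hg.memLp.coeFn_toLp
    let f₁ : modelSpace Θ := ⟨hf.memLp.toLp, (hΘ.mem_modelSpace_iff _).2 (hf.congr ef.symm)⟩
    let g₁ : modelSpace Θ := ⟨hg.memLp.toLp, (hΘ.mem_modelSpace_iff _).2 (hg.congr eg.symm)⟩
    have bf : MemLp (f₁ : L2 E) ∞ arc := hf'.ae_eq ef.symm
    have h1 := key bf (Lp.memLp (g₁ : L2 E))
    rw [← h f₁ g₁ bf, ← h' f₁ g₁ bf, sub_self] at h1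
    rw [← h1]
    refine integral_congr_ae ?_
    filter_upwards [ef, eg] with t h2 h3
    rw [h2, h3]
  · intro h' f g hf
    have h1 := key hf (Lp.memLp (g : L2 E))
    rw [h' _ _ ((hΘ.mem_modelSpace_iff _).1 f.2) hf ((hΘ.mem_modelSpace_iff _).1 g.2)] at h1
    rw [h f g hf]
    exact (sub_eq_zero.1 h1.symm).symm

/-- Symbols in `Θ H² + (Θ H²)^*` induce the zero operator. -/
theorem zeroSymbol_of_analytic (hΘ : IsInner Θ) {G K : Torus → E →L[ℂ] E}
    (hG : MemLp G 2 arc) (hK : MemLp K 2 arc) (sG : SpecGE 0 G) (sK : SpecGE 0 K) :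
    ZeroSymbol Θ (fun t => Θ t * G t + star (Θ t * K t)) := by
  intro f g hf bf hg
  have mGf := memLp_apply_right hG bf
  have m1 := memLp_apply_left hΘ.memLp_star hg.memLp
  have bΘf := memLp_apply_left hΘ.memLp_star bf
  have mKs : MemLp (fun t => star (K t)) 2 arc := hK.star
  have m2 := memLp_apply_right mKs bΘf
  -- In the first term `Θ^*` moves onto `g`, making it strictly antianalytic against the analytic `G
  -- f`. In the second it falls on `f`, and `K^* Θ^* f` is strictly antianalytic against the
  -- analytic `g`.
  have h1 : ∫ t, ⟪star (Θ t) (g t), G t (f t)⟫_ℂ ∂arc = 0 :=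
    integral_inner_eq_zero' mGf m1 (SpecGE.apply sG hf.specGE hG hf.memLp) hg.specLE (by norm_num)
  have h2 : ∫ t, ⟪g t, star (K t) (star (Θ t) (f t))⟫_ℂ ∂arc = 0 :=
    integral_inner_eq_zero hg.memLp m2 hg.specGE
      (SpecLE.apply (sK.star (integrable_of_memLp_two hK) rfl) hf.specLE mKs
        (bΘf.mono_exponent le_top)) (by norm_num)
  rw [← add_zero (0 : ℂ)]
  nth_rw 1 [← h1]
  rw [← h2, ← integral_add (integrable_inner_of_memLp m1 mGf)
    (integrable_inner_of_memLp hg.memLp m2)]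
  refine integral_congr_ae (.of_forall fun t => ?_)
  simp only [add_apply, inner_add_right, star_mul, inner_apply_star]
  rfl

/-- Every analytic square integrable `F` is of the form `Ψ + Θ G` with `Ψ ∈ M_Θ` and `G`
analytic. -/
theorem exists_symbol_decomposition (hΘ : IsInner Θ) {F : Torus → E →L[ℂ] E}
    (hF : MemLp F 2 arc) (sF : SpecGE 0 F) :
    ∃ Ψ G : Torus → E →L[ℂ] E, IsSymbol Θ Ψ ∧ MemLp G 2 arc ∧ SpecGE 0 G ∧
      ∀ t, F t = Ψ t + Θ t * G t := by
  have hΘF := memLp_mul_left hΘ.memLp_star hF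
  -- With `G = P_+(Θ^* F)`, the function `Θ^* (F - Θ G)` is the strictly antianalytic part of `Θ^*
  -- F`.
  obtain ⟨G, hG, sG, s⟩ := exists_riesz hΘF
  have hΘG := memLp_mul_left hΘ.memLp_top hG
  refine ⟨fun t => F t - Θ t * G t, G, ⟨hF.sub hΘG, ?_, ?_⟩, hG, sG, fun t => by simp⟩
  · exact sF.sub (SpecGE.mul hΘ.1 sG (Lp.memLp Θ) hG) (integrable_of_memLp_two hF)
      (integrable_of_memLp_two hΘG)
  · refine s.congr ?_
    filter_upwards [hΘ.2] with t ht
    rw [mul_sub, ← mul_assoc, Unitary.star_mul_self_of_mem ht, one_mul]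

end Model

/-! ### Density of bounded functions and uniqueness of the symbol -/

section Uniqueness

variable {E : Type*} [NormedAddCommGroup E] [InnerProductSpace ℂ E] [CompleteSpace E]
  {Θ : L2 (E →L[ℂ] E)}

/-- Neumann series for `I - Θ(0)Θ(0)^*`. This is where purity enters: it makes every vector the
value at `0` of some `k_0^Θ x`. -/
theorem IsPure.exists_inverse (hpure : IsPure Θ) :
    ∃ D : E →L[ℂ] E, fourierCoeff (kernelFun Θ 0) 0 * D = 1 := by
  rw [IsPure, discValue_zero] at hpure
  have h : ‖fourierCoeff Θ 0 * star (fourierCoeff Θ 0)‖ < 1 := by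
    refine (norm_mul_le _ _).trans_lt ?_
    rw [norm_star]
    nlinarith [norm_nonneg (fourierCoeff Θ 0)]
  rw [fourierCoeff_kernelFun]
  obtain ⟨u, hu⟩ := isUnit_one_sub_of_norm_lt_one h
  exact ⟨↑u⁻¹, by rw [← hu, Units.mul_inv]⟩

/-- The bounded elements `P_+(z^{-n} Θ x)`, `n ≥ 1`, of `K_Θ`. -/
theorem exists_bounded_model (hΘ : IsInner Θ) (x : E) (n : ℕ) :
    ∃ f p : Torus → E, IsModel Θ f ∧ MemLp f ∞ arc ∧ MemLp p 2 arc ∧ SpecLE (-1) p ∧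
      ∀ t, fourier (-(n + 1 : ℤ)) t • Θ t x = f t + p t := by
  induction n with
  | zero =>
    have bx := memLp_apply_const hΘ.memLp_top x
    have mx := memLp_apply_const (Lp.memLp Θ) x
    have sx : SpecGE 0 (fun t => Θ t x) := SpecGE.apply_const hΘ.1 (integrable_L2 Θ) x
    let c := fourierCoeff (fun t => Θ t x) 0
    have s2 : MemLp (fun t => star (Θ t)) 2 arc := (Lp.memLp Θ).star
    -- By unitarity `x - Θ^* c = Θ^* (Θ x - c)`. The base case is done by hand because `Θ x` itself
    -- need not lie in `K_Θ`.
    have hx : SpecLE 0 (fun t => x - star (Θ t) c) :=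
      (SpecLE.const x).sub
        (SpecLE.apply_const (SpecGE.star hΘ.1 (integrable_L2 Θ) rfl)
          (integrable_of_memLp_two s2) c) (integrable_const x)
        (integrable_of_memLp_two (memLp_apply_const s2 c))
    refine ⟨fun t => fourier (-1) t • (Θ t x - c), fun t => fourier (-1) t • c,
      ⟨memLp_fourier_smul (mx.sub (memLp_const c)) _, ?_, ?_⟩,
      memLp_top_backwardShift bx, memLp_fourier_smul (memLp_const c) _, ?_, fun t => ?_⟩
    · exact ((sx.sub_mean (integrable_of_memLp_two mx)).fourier_smul (-1)).mono le_rfl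
    · refine ((hx.fourier_smul (-1)).mono le_rfl).congr ?_
      filter_upwards [hΘ.star_apply_apply] with t ht
      rw [map_smul, map_sub, ht]
    · exact ((SpecLE.const c).fourier_smul (-1)).mono le_rfl
    · simp [smul_sub]
  | succ n ih =>
    obtain ⟨f, p, hf, bf, hp, sp, h⟩ := ih
    let c := fourierCoeff f 0
    -- The constant removed from `f` by the backward shift joins the antianalytic remainder.
    refine ⟨_, fun t => fourier (-1) t • (p t + c), hf.backwardShift hΘ,
      memLp_top_backwardShift bf, memLp_fourier_smul (hp.add (memLp_const c)) _, ?_, fun t => ?_⟩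
    · exact (((sp.mono (by norm_num)).add (SpecLE.const c) (integrable_of_memLp_two hp)
        (integrable_const c)).fourier_smul (-1)).mono le_rfl
    · have e : (-((n + 1 : ℕ) + 1 : ℤ)) = -1 + -(n + 1 : ℤ) := by push_cast; ring
      rw [e, fourier_add, mul_smul, h t, ← smul_add]
      congr 1
      simp only [c]
      abel

variable [FiniteDimensional ℂ E]

/-- The bounded functions are dense in `K_Θ`. -/
theorem IsModel.ae_eq_zero (hΘ : IsInner Θ) {w : Torus → E} (hw : IsModel Θ w)
    (h : ∀ f, IsModel Θ f → MemLp f ∞ arc → ∫ t, ⟪w t, f t⟫_ℂ ∂arc = 0) : w =ᵐ[arc] 0 := by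
  have m := memLp_apply_left hΘ.memLp_star hw.memLp
  have h0 : (fun t => star (Θ t) (w t)) =ᵐ[arc] 0 := by
    refine ae_eq_zero_of_fourierCoeff m fun k => ?_
    rcases lt_or_ge (-1) k with hk | hk
    · exact hw.specLE k hk
    -- This coefficient of `Θ^* w`, paired with `x`, is the integral of `⟨w, z^{-(n+1)} Θ x⟩ = ⟨w,
    -- f⟩ + ⟨w, p⟩`: the first term vanishes by hypothesis, the second because `w` is analytic and
    -- `p` strictly antianalytic.
    obtain ⟨n, rfl⟩ : ∃ n : ℕ, k = -(n + 1 : ℤ) := ⟨(-k - 1).toNat, by omega⟩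
    refine ext_inner_right ℂ fun x => ?_
    obtain ⟨f, p, hf, bf, hp, sp, he⟩ := exists_bounded_model hΘ x n
    have h1 := h f hf bf
    have h2 := integral_inner_eq_zero hw.memLp hp hw.specGE sp (by norm_num)
    rw [inner_zero_left, fourierCoeff, ← integral_inner_const_right
      ((integrable_of_memLp_two m).fourier_smul _), ← add_zero (0 : ℂ)]
    nth_rw 1 [← h1]
    rw [← h2, ← integral_add (integrable_inner_of_memLp hw.memLp hf.memLp)
      (integrable_inner_of_memLp hw.memLp hp)]
    refine integral_congr_ae (.of_forall fun t => ?_)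
    simp only [← inner_add_right, ← he t, inner_smul_left, inner_smul_right, inner_apply_star]
    rw [fourier_neg, Complex.conj_conj, fourier_neg]
  filter_upwards [h0, hΘ.apply_star_apply] with t h1 h2
  rw [← h2 (w t), h1]
  simp

/-- If `A_{U + V^*} = 0`, then `⟨U f(0), g⟩ + ⟨f, V g(0)⟩ = 0` on `K_Θ`. -/
theorem ZeroSymbol.integral_mean (hΘ : IsInner Θ) {U V : Torus → E →L[ℂ] E} (hU : IsSymbol Θ U)
    (hV : IsSymbol Θ V) (hZ : ZeroSymbol Θ (fun t => U t + star (V t))) {f g : Torus → E}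
    (hf : IsModel Θ f) (bf : MemLp f ∞ arc) (hg : IsModel Θ g) :
    ∫ t, ⟪g t, U t (fourierCoeff f 0)⟫_ℂ ∂arc
      + ∫ t, ⟪V t (fourierCoeff g 0), f t⟫_ℂ ∂arc = 0 := by
  set f₀ := fourierCoeff f 0
  set g₀ := fourierCoeff g 0
  have mΦ : MemLp (fun t => U t + star (V t)) 2 arc := hU.memLp.add hV.memLp.star
  have bf' : MemLp (fun t => f t - f₀) ∞ arc := bf.sub (memLp_const f₀)
  have mf' : MemLp (fun t => f t - f₀) 2 arc := hf.memLp.sub (memLp_const f₀)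
  have mg' : MemLp (fun t => g t - g₀) 2 arc := hg.memLp.sub (memLp_const g₀)
  have mΦf := memLp_apply_right mΦ bf
  have mΦf' := memLp_apply_right mΦ bf'
  have mUf' := memLp_apply_right hU.memLp bf'
  have mVg₀ := memLp_apply_const hV.memLp g₀
  have mUf₀ := memLp_apply_const hU.memLp f₀
  have iVg := integrable_apply hV.memLp hg.memLp
  have i1 := integrable_inner_of_memLp hg.memLp mΦf
  have i2 := integrable_inner_of_memLp mg' mΦf'
  have i3 : Integrable (fun t => ⟪V t (g t), f₀⟫_ℂ) arc := iVg.inner_const f₀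
  have i4 := integrable_inner_of_memLp mVg₀ (memLp_const f₀)
  have i5 := integrable_inner_of_memLp (memLp_const g₀) mUf'
  have h1 : ∫ t, ⟪g t, (U t + star (V t)) (f t)⟫_ℂ ∂arc = 0 := hZ f g hf bf hg
  have h2 : ∫ t, ⟪g t - g₀, (U t + star (V t)) (f t - f₀)⟫_ℂ ∂arc = 0 := by
    -- The factors `z^{-1}` of the two backward shifts cancel in the inner product.
    rw [← hZ _ _ (hf.backwardShift hΘ) (memLp_top_backwardShift bf) (hg.backwardShift hΘ)]
    refine integral_congr_ae (.of_forall fun t => ?_)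
    simp only [map_smul, inner_smul_left, inner_smul_right]
    rw [← mul_assoc, ← fourier_neg, ← fourier_add]
    simp only [neg_neg, neg_add_cancel, fourier_zero, one_mul]
    rfl
  have h3 : ∫ t, ⟪V t (g t), f₀⟫_ℂ ∂arc = ⟪fourierCoeff V 0 g₀, f₀⟫_ℂ := by
    rw [integral_inner_const_right iVg,
      integral_apply_of_specGE hV.memLp hg.memLp hV.specGE hg.specGE]
  have h4 : ∫ t, ⟪V t g₀, f₀⟫_ℂ ∂arc = ⟪fourierCoeff V 0 g₀, f₀⟫_ℂ := by
    rw [integral_inner_const_right (integrable_of_memLp_two mVg₀), ← fourierCoeff_zero_index,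
      fourierCoeff_apply_const (integrable_of_memLp_two hV.memLp)]
  have h5 : ∫ t, ⟪g₀, U t (f t - f₀)⟫_ℂ ∂arc = 0 :=
    integral_inner_eq_zero' mUf' (memLp_const g₀)
      (SpecGE.apply hU.specGE (hf.specGE.sub_mean (integrable_of_memLp_two hf.memLp))
        hU.memLp mf') (SpecLE.const g₀) (by norm_num)
  -- After integration both differences in parentheses vanish, the second because `(V g)(0) = V(0)
  -- g(0)`; the last term has mean zero since `U (f - f(0))` vanishes at `0`.
  have e : ∀ t, ⟪g t, U t f₀⟫_ℂ + ⟪V t g₀, f t⟫_ℂ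
      = (⟪g t, (U t + star (V t)) (f t)⟫_ℂ - ⟪g t - g₀, (U t + star (V t)) (f t - f₀)⟫_ℂ)
        - (⟪V t (g t), f₀⟫_ℂ - ⟪V t g₀, f₀⟫_ℂ) - ⟪g₀, U t (f t - f₀)⟫_ℂ := by
    intro t
    simp only [add_apply, map_sub, inner_sub_left, inner_sub_right,
      inner_add_right, inner_star_apply]
    ring
  rw [← integral_add (integrable_inner_of_memLp hg.memLp mUf₀)
    (integrable_inner_of_memLp mVg₀ hf.memLp)]
  simp only [e]
  have i6 : Integrable (fun t => ⟪g t, (U t + star (V t)) (f t)⟫_ℂ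
      - ⟪g t - g₀, (U t + star (V t)) (f t - f₀)⟫_ℂ) arc := i1.sub i2
  have i7 : Integrable (fun t => ⟪V t (g t), f₀⟫_ℂ - ⟪V t g₀, f₀⟫_ℂ) arc := i3.sub i4
  rw [integral_sub (by exact i6.sub i7) i5, integral_sub i6 i7,
    integral_sub i1 i2, integral_sub i3 i4, h1, h2, h3, h4, h5]
  simp

/-- If `A_{U + V^*} = 0` with `U, V ∈ M_Θ`, then `U = k_0^Θ X` and `V = - k_0^Θ X^*`. -/
theorem ZeroSymbol.exists_kernelFun (hΘ : IsInner Θ) (hpure : IsPure Θ)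
    {U V : Torus → E →L[ℂ] E} (hU : IsSymbol Θ U) (hV : IsSymbol Θ V)
    (hZ : ZeroSymbol Θ (fun t => U t + star (V t))) :
    ∃ X : E →L[ℂ] E, (U =ᵐ[arc] fun t => kernelFun Θ 0 t * X) ∧
      (V =ᵐ[arc] fun t => -(kernelFun Θ 0 t * star X)) := by
  obtain ⟨D, hD⟩ := hpure.exists_inverse
  have hk := isSymbol_kernelFun hΘ
  have bk : ∀ x, MemLp (fun t => kernelFun Θ 0 t x) ∞ arc :=
    memLp_apply_const (memLp_top_kernelFun hΘ)
  have hD' : ∀ y, fourierCoeff (fun t => kernelFun Θ 0 t (D y)) 0 = y := fun y => by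
    rw [fourierCoeff_apply_const (integrable_of_memLp_two hk.memLp)]
    exact congrArg (fun T : E →L[ℂ] E => T y) hD
  -- Forced by `f = k_0 D y`: `⟨g, U y⟩ = -⟨V(0) g(0), D y⟩ = -⟨g, k_0 V(0)^* D y⟩`.
  let X : E →L[ℂ] E := -(star (fourierCoeff V 0) * D)
  have hUX : U =ᵐ[arc] fun t => kernelFun Θ 0 t * X := by
    refine ae_eq_of_forall_apply fun y => ?_
    let z := star (fourierCoeff V 0) (D y)
    have hw := (hU.apply_const hΘ y).add hΘ (hk.apply_const hΘ z)
    have hg : ∀ g, IsModel Θ g → ∫ t, ⟪g t, U t y + kernelFun Θ 0 t z⟫_ℂ ∂arc = 0 := by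
      intro g hg
      have h1 := hZ.integral_mean hΘ hU hV (hk.apply_const hΘ (D y)) (bk (D y)) hg
      rw [hD', (hV.apply_const hΘ _).integral_inner_kernelFun hΘ,
        fourierCoeff_apply_const (integrable_of_memLp_two hV.memLp), ← inner_star_apply,
        ← hg.integral_inner_kernelFun hΘ, ← integral_add
        (integrable_inner_of_memLp hg.memLp (hU.apply_const hΘ y).memLp)
        (integrable_inner_of_memLp hg.memLp (hk.apply_const hΘ z).memLp)] at h1
      simpa only [inner_add_right] using h1
    -- The slot of `g` admits unbounded functions, so `g` may be `U y + k_0 z` itself.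
    filter_upwards [ae_eq_zero_of_integral_inner_self hw.memLp (hg _ hw)] with t ht
    have : U t y = -(kernelFun Θ 0 t z) := eq_neg_of_add_eq_zero_left ht
    rw [this]
    simp [X, z]
  refine ⟨X, hUX, ae_eq_of_forall_apply fun y => ?_⟩
  have hw := (hV.apply_const hΘ y).add hΘ (hk.apply_const hΘ (star X y))
  -- Here the free slot is that of the bounded `f`, so density is needed. Reproducing twice turns
  -- `⟨k_0 D y, k_0 X f(0)⟩` into `⟨k_0 X^* y, f⟩`.
  filter_upwards [hw.ae_eq_zero hΘ fun f hf bf => by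
    have h1 := hZ.integral_mean hΘ hU hV hf bf (hk.apply_const hΘ (D y))
    have h2 : ∫ t, ⟪kernelFun Θ 0 t (D y), U t (fourierCoeff f 0)⟫_ℂ ∂arc
        = ∫ t, ⟪kernelFun Θ 0 t (star X y), f t⟫_ℂ ∂arc := by
      have h3 : ∫ t, ⟪kernelFun Θ 0 t (D y), U t (fourierCoeff f 0)⟫_ℂ ∂arc
          = ∫ t, ⟪kernelFun Θ 0 t (D y), kernelFun Θ 0 t (X (fourierCoeff f 0))⟫_ℂ ∂arc :=
        integral_congr_ae (hUX.mono fun t ht => by simp only [ht]; rfl)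
      rw [h3, (hk.apply_const hΘ _).integral_inner_kernelFun hΘ, hD', integral_inner_swap,
        hf.integral_inner_kernelFun hΘ, inner_conj_symm, inner_apply_star]
    rw [hD', h2, add_comm, ← integral_add
      (integrable_inner_of_memLp (hV.apply_const hΘ y).memLp hf.memLp)
      (integrable_inner_of_memLp (hk.apply_const hΘ _).memLp hf.memLp)] at h1
    simpa only [inner_add_left] using h1] with t ht
  have : V t y = -(kernelFun Θ 0 t (star X y)) := eq_neg_of_add_eq_zero_left ht
  rw [this]
  simp

end Uniqueness

end MTTO

end

/-! ### The main theorem -/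

theorem mainTheorem4 {E : Type*} [NormedAddCommGroup E] [InnerProductSpace ℂ E]
    [CompleteSpace E] [FiniteDimensional ℂ E]
    (Θ : MTTO.L2 (E →L[ℂ] E)) (hΘ : MTTO.IsInner Θ) (hpure : MTTO.IsPure Θ)
    (A : MTTO.modelSpace Θ →L[ℂ] MTTO.modelSpace Θ) (hA : MTTO.IsMTTO Θ A) :
    (∃ Ψ₁ ∈ MTTO.symbolSpace Θ, ∃ Ψ₂ ∈ MTTO.symbolSpace Θ,
      MTTO.HasSymbol Θ A (Ψ₁ + star Ψ₂)) ∧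
    (∀ Ψ₁ ∈ MTTO.symbolSpace Θ, ∀ Ψ₂ ∈ MTTO.symbolSpace Θ,
      MTTO.HasSymbol Θ A (Ψ₁ + star Ψ₂) →
      ∀ Ψ₁' Ψ₂' : MTTO.L2 (E →L[ℂ] E),
        (Ψ₁' ∈ MTTO.symbolSpace Θ ∧ Ψ₂' ∈ MTTO.symbolSpace Θ ∧
          MTTO.HasSymbol Θ A (Ψ₁' + star Ψ₂')) ↔
        ∃ X : E →L[ℂ] E,
          (Ψ₁' =ᵐ[MTTO.arc] fun t => Ψ₁ t + MTTO.kernelFun Θ 0 t * X) ∧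
          (Ψ₂' =ᵐ[MTTO.arc] fun t => Ψ₂ t - MTTO.kernelFun Θ 0 t * star X)) := by
  open MTTO in
  have coe : ∀ Ψ₁ Ψ₂ : L2 (E →L[ℂ] E),
      ∀ᵐ t ∂arc, (Ψ₁ + star Ψ₂ : L2 (E →L[ℂ] E)) t = Ψ₁ t + star (Ψ₂ t) := by
    intro Ψ₁ Ψ₂
    filter_upwards [Lp.coeFn_add Ψ₁ (star Ψ₂), Lp.coeFn_star Ψ₂] with t h1 h2
    rw [h1, Pi.add_apply, h2, Pi.star_apply]
  constructor
  · obtain ⟨Φ, hΦ⟩ := hA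
    have mΦ := Lp.memLp Φ
    obtain ⟨F, mF, sF, sR⟩ := exists_riesz mΦ
    have mR : MemLp (fun t => Φ t - F t) 2 arc := mΦ.sub mF
    have mR' : MemLp (fun t => star (Φ t - F t)) 2 arc := mR.star
    have sR' : SpecGE 0 (fun t => star (Φ t - F t)) :=
      (sR.star (integrable_of_memLp_two mR) rfl).mono (by norm_num)
    obtain ⟨Ψ₁, G₁, hΨ₁, mG₁, sG₁, h1⟩ := exists_symbol_decomposition hΘ mF sF
    obtain ⟨Ψ₂, G₂, hΨ₂, mG₂, sG₂, h2⟩ := exists_symbol_decomposition hΘ mR' sR'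
    have e1 := hΨ₁.memLp.coeFn_toLp
    have e2 := hΨ₂.memLp.coeFn_toLp
    refine ⟨hΨ₁.memLp.toLp, (hΘ.mem_symbolSpace_iff _).2 (hΨ₁.congr e1.symm),
      hΨ₂.memLp.toLp, (hΘ.mem_symbolSpace_iff _).2 (hΨ₂.congr e2.symm),
      (hΦ.iff_zeroSymbol hΘ _).2 ?_⟩
    -- The new symbol minus `Φ` is `-Θ G₁ - (Θ G₂)^*`.
    have hz := zeroSymbol_of_analytic hΘ mG₁.neg mG₂.neg
      (fun n hn => by simpa [fourierCoeff, integral_neg] using sG₁ n hn)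
      (fun n hn => by simpa [fourierCoeff, integral_neg] using sG₂ n hn)
    refine hz.congr ?_
    filter_upwards [coe (hΨ₁.memLp.toLp) (hΨ₂.memLp.toLp), e1, e2] with t h3 h4 h5
    have h6 : Φ t = F t + star (star (Φ t - F t)) := by rw [star_star]; abel
    rw [h3, h4, h5, h6, h2, h1]
    simp only [Pi.neg_apply, mul_neg, star_neg, star_add]
    abel
  · intro Ψ₁ hΨ₁ Ψ₂ hΨ₂ hS Ψ₁' Ψ₂'
    simp only [hΘ.mem_symbolSpace_iff] at hΨ₁ hΨ₂ ⊢
    have hk := isSymbol_kernelFun hΘ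
    rw [hS.iff_zeroSymbol hΘ]
    constructor
    · rintro ⟨hΨ₁', hΨ₂', hZ⟩
      obtain ⟨X, hX1, hX2⟩ := ZeroSymbol.exists_kernelFun hΘ hpure (hΨ₁'.sub hΘ hΨ₁)
        (hΨ₂'.sub hΘ hΨ₂) (hZ.congr (by
          filter_upwards [coe Ψ₁ Ψ₂, coe Ψ₁' Ψ₂'] with t h1 h2
          rw [h1, h2, star_sub]
          abel))
      refine ⟨X, ?_, ?_⟩
      · filter_upwards [hX1] with t ht
        rw [← ht]
        abel
      · filter_upwards [hX2] with t ht
        rw [sub_eq_add_neg, ← ht]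
        abel
    · rintro ⟨X, hX1, hX2⟩
      refine ⟨(hΨ₁.add hΘ (hk.mul_const hΘ X)).congr hX1.symm,
        (hΨ₂.sub hΘ (hk.mul_const hΘ (star X))).congr hX2.symm, ?_⟩
      let T := star (fourierCoeff Θ 0)
      -- In `k_0 X - (k_0 X^*)^*` the constants `X` cancel, leaving `-Θ Θ(0)^* X + (Θ Θ(0)^*
      -- X^*)^*`.
      refine (zeroSymbol_of_analytic hΘ (memLp_const (-(T * X))) (memLp_const (T * star X))
        (SpecGE.const _) (SpecGE.const _)).congr ?_
      filter_upwards [coe Ψ₁ Ψ₂, coe Ψ₁' Ψ₂', hX1, hX2] with t h1 h2 h3 h4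
      rw [h1, h2, h3, h4, kernelFun_zero]
      simp only [sub_mul, star_sub, star_mul, star_star, mul_assoc, T, one_mul, mul_neg]
      abel
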